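/- For $\alpha>0$ and $z\in\mathbb{H}=\{z\in\mathbb{C}:\operatorname{Im}z>0\}$ let $$\mathcal{K}(\alpha;z):=\sum_{(m,n)\in\mathbb{Z}^2}\frac{|mz+n|^2}{\operatorname{Im}(z)}\,e^{-\pi\alpha\frac{|mz+n|^2}{\operatorname{Im}(z)}},$$ and let $\Gamma_c:=\{z\in\mathbb{H}:\operatorname{Re}z=\tfrac12,\ \operatorname{Im}z\ge\tfrac{\sqrt3}{2}\}$. **Proposition 4.3.** Assume that $\alpha\ge 2$. Then the function $z\mapsto\mathcal{K}(\alpha;z)-2\,\mathcal{K}(2\alpha;z)$ attains its minimum over $\Gamma_c$ at the hexagonal point $e^{i\pi/3}=\tfrac12+i\tfrac{\sqrt3}{2}$ and at no other point of $\Gamma_c$, that is, $$\operatorname*{argmin}_{z\in\Gamma_c}\big(\mathcal{K}(\alpha;z)-2\,\mathcal{K}(2\alpha;z)\big)=\{e^{i\pi/3}\}.$$ -/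

import Mathlib

open UpperHalfPlane

noncomputable section

/-- The squared length `|m z + n|² / Im z` of the vector with coordinates `(m, n)` in the
unit-density lattice `(Im z)^(-1/2) (ℤ ⊕ z ℤ)`. -/
def latticeNormSq (z : ℍ) (p : ℤ × ℤ) : ℝ :=
  ‖(p.1 : ℂ) * (z : ℂ) + (p.2 : ℂ)‖ ^ 2 / z.im

/-- The lattice sum `𝒦(α; z) = ∑_{(m,n) ∈ ℤ²} (|m z + n|² / Im z) exp(-π α |m z + n|² / Im z)`.
It converges for every `α > 0`, see `summable_latticeK`. -/
def latticeK (α : ℝ) (z : ℍ) : ℝ :=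
  ∑' p : ℤ × ℤ, latticeNormSq z p * Real.exp (-Real.pi * α * latticeNormSq z p)

/-- The series defining `𝒦(α; z)` converges (so that the `tsum` is a genuine sum). -/
theorem summable_latticeK {α : ℝ} (hα : 0 < α) (z : ℍ) :
    Summable fun p : ℤ × ℤ =>
      latticeNormSq z p * Real.exp (-Real.pi * α * latticeNormSq z p) := by
  have hc : 0 < Real.pi * α := mul_pos Real.pi_pos hα
  have hz := z.im_pos
  have hs := ((summable_prod_eisSummand (k := 4) (by norm_num) z).norm).mul_left
    (6 / (Real.pi * α) ^ 3 * z.im ^ 2)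
  refine hs.of_nonneg_of_le (fun p => ?_) (fun p => ?_)
  · unfold latticeNormSq
    positivity
  · have hq : ‖EisensteinSeries.eisSummand ((4 : ℕ) : ℤ) ![p.1, p.2] z‖
        = (‖(p.1 : ℂ) * (z : ℂ) + (p.2 : ℂ)‖ ^ 4)⁻¹ := by
      simp only [EisensteinSeries.eisSummand, Matrix.cons_val_zero, Matrix.cons_val_one,
        zpow_neg, zpow_natCast, norm_inv, norm_pow]
    rw [hq]
    unfold latticeNormSq
    generalize ‖(p.1 : ℂ) * (z : ℂ) + (p.2 : ℂ)‖ = N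
    rcases eq_or_ne N 0 with h | h
    · simp [h]
    have hN : 0 < N ^ 2 / z.im := by positivity
    have hrhs : 6 / (Real.pi * α) ^ 3 * z.im ^ 2 * (N ^ 4)⁻¹
        = 6 / (Real.pi * α) ^ 3 / (N ^ 2 / z.im) ^ 2 := by
      field_simp
    rw [hrhs]
    generalize N ^ 2 / z.im = q at hN
    have hx : 0 ≤ Real.pi * α * q := by positivity
    have he := Real.pow_div_factorial_le_exp (Real.pi * α * q) hx 3
    rw [show -Real.pi * α * q = -(Real.pi * α * q) by ring, Real.exp_neg]
    have h6 : ((Nat.factorial 3 : ℕ) : ℝ) = 6 := by norm_num [Nat.factorial]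
    rw [h6] at he
    calc q * (Real.exp (Real.pi * α * q))⁻¹
        ≤ q * ((Real.pi * α * q) ^ 3 / 6)⁻¹ := by gcongr
      _ = 6 / (Real.pi * α) ^ 3 / q ^ 2 := by field_simp

/-- The closed vertical half-line `Γ_c = {z ∈ ℍ : Re z = 1/2, Im z ≥ √3/2}`. -/
def gammaC : Set ℍ := {z | z.re = 1 / 2 ∧ Real.sqrt 3 / 2 ≤ z.im}

/-- The hexagonal point `e^{iπ/3}`. -/
def hexPoint : ℍ :=
  ⟨Complex.exp (Complex.I * (Real.pi / 3)), by
    have h : Complex.I * (Real.pi / 3) = ((Real.pi / 3 : ℝ) : ℂ) * Complex.I := by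
      push_cast
      ring
    rw [h, Complex.exp_ofReal_mul_I_im, Real.sin_pi_div_three]
    positivity⟩

/-- The set of minimizers of `f` on `s`: the points of `s` at which `f` attains its minimum
over `s`. -/
def argminOn {X : Type*} (f : X → ℝ) (s : Set X) : Set X := {x | x ∈ s ∧ IsMinOn f s x}

end

/-! With `c = πα` and `φ(u) = u e^{-u} - 2u e^{-2u}`, the quantity to minimize is, up to the factor
`πα`, the lattice energy `E(y) = ∑ φ(c Q_y(p))`, where `Q_y` is the norm form at `1/2 + iy`. At `y =
√3/2` the form is `(2/√3) N` with `N = m² + mn + n²`. Put `u = 2c/√3`; then `α ≥ 2` gives `c ≥ 6.28`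
and `u ≥ 7.25`. The six shortest vectors dominate, so `E(√3/2) ≤ 6.1 u e^{-u}`
(`halfEnergy_hex_le`). Three ranges of `y` remain.

For `y ≤ 6/5` (`halfEnergy_lt_of_le`) all nonzero arguments are at least 5, where `φ` is convex, so
`φ` lies above its tangents at the points `uN(p)`. Averaging the linear terms over the hexagonal
rotation cancels the first order in `y - √3/2` and leaves a loss of second order
(`tsum_mul_halfForm_sub`). The quadratic convexity gain of the two vectors `(0, ±1)`, which get
shorter, exceeds this loss (`near_gain_pos`).

For `y ≥ 6/5` and `c/y ≥ 4/5` (`halfEnergy_lt_of_ge`) no term is negative, and `(0, ±1)` alone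
contribute more than `6.1 u e^{-u}`.

For `c/y ≤ 4/5` (`halfEnergy_lt_of_div_le`) the row `m = 0` has many comparable terms, some possibly
negative. Poisson summation bounds its sum below by `0.04`, which exceeds `6.1 u e^{-u}`. -/

/-! ### Convexity and numerical bounds for the one-variable profile. -/

/-- A quadratic lower bound at `x₀` for a function whose second derivative is at least `K`. -/
theorem tangent_add_sq_le {D : Set ℝ} (hD : Convex ℝ D) {f f' f'' : ℝ → ℝ}
    (hf : ∀ x, HasDerivAt f (f' x) x) (hf' : ∀ x, HasDerivAt f' (f'' x) x) {K : ℝ}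
    (hK : ∀ x ∈ D, K ≤ f'' x) {x₀ x : ℝ} (hx₀ : x₀ ∈ D) (hx : x ∈ D) :
    f x₀ + f' x₀ * (x - x₀) + K / 2 * (x - x₀) ^ 2 ≤ f x := by
  have hg : ∀ x, HasDerivAt (fun x => f x - K / 2 * (x - x₀) ^ 2) (f' x - K * (x - x₀)) x := by
    intro x
    have h := (((hasDerivAt_id x).sub_const x₀).pow 2).const_mul (K / 2)
    exact ((hf x).sub h).congr_deriv (by simp; ring)
  have hg' : ∀ x, HasDerivAt (fun x => f' x - K * (x - x₀)) (f'' x - K) x := by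
    intro x
    have h := ((hasDerivAt_id x).sub_const x₀).const_mul K
    exact ((hf' x).sub h).congr_deriv (by simp)
  have hconv : ConvexOn ℝ D (fun x => f x - K / 2 * (x - x₀) ^ 2) :=
    convexOn_of_hasDerivWithinAt2_nonneg hD
      (fun x _ => (hg x).continuousAt.continuousWithinAt)
      (fun x _ => (hg x).hasDerivWithinAt) (fun x _ => (hg' x).hasDerivWithinAt)
      (fun x hx => sub_nonneg.2 (hK x (interior_subset hx)))
  have h₀ : HasDerivAt (fun x => f x - K / 2 * (x - x₀) ^ 2) (f' x₀) x₀ := by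
    simpa using hg x₀
  rcases lt_trichotomy x x₀ with h | h | h
  · have := hconv.slope_le_of_hasDerivAt hx hx₀ h h₀
    rw [slope_def_field, div_le_iff₀ (by linarith)] at this
    simp only [sub_self] at this
    linarith
  · subst h; simp
  · have := hconv.le_slope_of_hasDerivAt hx₀ hx h h₀
    rw [slope_def_field, le_div_iff₀ (by linarith)] at this
    simp only [sub_self] at this
    linarith

/-- The one-variable profile `u e^{-u} - 2u e^{-2u}` of the energy. -/
noncomputable def profile (u : ℝ) : ℝ := u * Real.exp (-u) - 2 * u * Real.exp (-(2 * u))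

/-- The derivative of `profile`. -/
noncomputable def profileDeriv (u : ℝ) : ℝ :=
  (1 - u) * Real.exp (-u) - (2 - 4 * u) * Real.exp (-(2 * u))

/-- The second derivative of `profile`. -/
noncomputable def profileDeriv₂ (u : ℝ) : ℝ :=
  (u - 2) * Real.exp (-u) - (8 * u - 8) * Real.exp (-(2 * u))

theorem hasDerivAt_exp_neg_const_mul (k u : ℝ) :
    HasDerivAt (fun u : ℝ => Real.exp (-(k * u))) (-k * Real.exp (-(k * u))) u := by
  have h := (((hasDerivAt_id u).const_mul k).neg).exp
  exact h.congr_deriv (by simp [mul_comm])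

theorem hasDerivAt_exp_neg' (u : ℝ) :
    HasDerivAt (fun u : ℝ => Real.exp (-u)) (-Real.exp (-u)) u := by
  simpa using hasDerivAt_exp_neg_const_mul 1 u

theorem hasDerivAt_profile (u : ℝ) : HasDerivAt profile (profileDeriv u) u := by
  have h := ((hasDerivAt_id u).mul (hasDerivAt_exp_neg' u)).sub
    (((hasDerivAt_id u).const_mul 2).mul (hasDerivAt_exp_neg_const_mul 2 u))
  exact h.congr_deriv (by simp [profileDeriv]; ring)

theorem hasDerivAt_profileDeriv (u : ℝ) : HasDerivAt profileDeriv (profileDeriv₂ u) u := by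
  have h := (((hasDerivAt_id u).const_sub 1).mul (hasDerivAt_exp_neg' u)).sub
    ((((hasDerivAt_id u).const_mul 4).const_sub 2).mul (hasDerivAt_exp_neg_const_mul 2 u))
  exact h.congr_deriv (by simp [profileDeriv₂]; ring)

theorem exp_neg_two_mul (u : ℝ) : Real.exp (-(2 * u)) = Real.exp (-u) ^ 2 := by
  rw [← Real.exp_nat_mul]; congr 1; push_cast; ring

theorem exp_neg_natCast_lt (n : ℕ) (hn : n ≠ 0) : Real.exp (-(n : ℝ)) < (1 / 2.718) ^ n := by
  rw [Real.exp_neg, ← Real.exp_one_pow, one_div, inv_pow]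
  have := Real.exp_one_gt_d9
  have h : (2.718 : ℝ) ^ n < Real.exp 1 ^ n := by gcongr; linarith
  gcongr

theorem exp_neg_le_of_natCast_le (n : ℕ) (hn : n ≠ 0) {u : ℝ} (hu : (n : ℝ) ≤ u) :
    Real.exp (-u) ≤ (1 / 2.718) ^ n :=
  (Real.exp_le_exp.2 (neg_le_neg hu)).trans (exp_neg_natCast_lt n hn).le

/-- Past 5 the `e^{-2u}` part is a small perturbation: `e^{-5} < 0.0068` makes it at most a tenth of
the main part. -/
theorem le_profileDeriv₂ {u : ℝ} (hu : 5 ≤ u) :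
    9 / 10 * ((u - 2) * Real.exp (-u)) ≤ profileDeriv₂ u := by
  have h := exp_neg_le_of_natCast_le 5 (by norm_num) (u := u) (by exact_mod_cast hu)
  have h' : Real.exp (-u) ≤ 0.0068 := h.trans (by norm_num)
  have hpos := Real.exp_pos (-u)
  rw [profileDeriv₂, exp_neg_two_mul]
  have : (8 * u - 8) * Real.exp (-u) ≤ (8 * u - 8) * 0.0068 := by gcongr; linarith
  nlinarith

theorem sub_mul_exp_neg_antitoneOn (a : ℝ) :
    AntitoneOn (fun u : ℝ => (u - a) * Real.exp (-u)) (Set.Ici (a + 1)) := by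
  intro u hu v _ huv
  simp only [Set.mem_Ici] at hu
  have h := Real.add_one_le_exp (v - u)
  have hv : Real.exp (-u) = Real.exp (v - u) * Real.exp (-v) := by
    rw [← Real.exp_add]; congr 1; ring
  have hpos := Real.exp_pos (-v)
  show (v - a) * Real.exp (-v) ≤ (u - a) * Real.exp (-u)
  rw [hv, ← mul_assoc]
  gcongr
  nlinarith

theorem mul_exp_neg_antitoneOn :
    AntitoneOn (fun u : ℝ => u * Real.exp (-u)) (Set.Ici 1) := by
  simpa using sub_mul_exp_neg_antitoneOn 0

theorem profile_tangent_le {u₀ u : ℝ} (hu₀ : 5 ≤ u₀) (hu : 5 ≤ u) :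
    profile u₀ + profileDeriv u₀ * (u - u₀) ≤ profile u := by
  have := tangent_add_sq_le (convex_Ici (5 : ℝ)) hasDerivAt_profile hasDerivAt_profileDeriv
    (K := 0) (fun x hx => by
      refine le_trans ?_ (le_profileDeriv₂ hx)
      have : (5 : ℝ) ≤ x := hx
      have : 0 ≤ x - 2 := by linarith
      positivity) (x₀ := u₀) (x := u) hu₀ hu
  linarith

/-- Moving left from `u₀` matters: `(x - 2) e^{-x}` decreases past 3, so on `[u, u₀]` its least
value is the one at `u₀`. -/
theorem profile_tangent_add_sq_le {u₀ u : ℝ} (hu : 5 ≤ u) (huu₀ : u ≤ u₀) :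
    profile u₀ + profileDeriv u₀ * (u - u₀)
      + 9 / 20 * ((u₀ - 2) * Real.exp (-u₀)) * (u - u₀) ^ 2 ≤ profile u := by
  have := tangent_add_sq_le (convex_Icc (5 : ℝ) u₀) hasDerivAt_profile hasDerivAt_profileDeriv
    (K := 9 / 10 * ((u₀ - 2) * Real.exp (-u₀))) (fun x hx => by
      refine le_trans ?_ (le_profileDeriv₂ hx.1)
      have := sub_mul_exp_neg_antitoneOn 2 (show x ∈ Set.Ici (2 + 1 : ℝ) by
          simp only [Set.mem_Ici]; linarith [hx.1])
        (show u₀ ∈ Set.Ici (2 + 1 : ℝ) by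
          simp only [Set.mem_Ici]; linarith [hx.1, hx.2]) hx.2
      simp only at this
      linarith) (x₀ := u₀) (x := u) ⟨hu.trans huu₀, le_rfl⟩ ⟨hu, huu₀⟩
  linarith

theorem profile_le {u : ℝ} (hu : 0 ≤ u) : profile u ≤ u * Real.exp (-u) := by
  unfold profile
  have : 0 ≤ 2 * u * Real.exp (-(2 * u)) := by positivity
  linarith

theorem profile_eq (u : ℝ) : profile u = u * Real.exp (-u) * (1 - 2 * Real.exp (-u)) := by
  rw [profile, exp_neg_two_mul]; ring

theorem exp_neg_four_fifths_lt : Real.exp (-(4 / 5 : ℝ)) < 0.45 := by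
  rw [Real.exp_neg, inv_lt_comm₀ (Real.exp_pos _) (by norm_num)]
  have := Real.sum_le_exp_of_nonneg (x := 4 / 5) (by norm_num) 5
  norm_num [Finset.sum_range_succ, Nat.factorial] at this
  norm_num
  linarith

/-- The sign of the profile changes at `u = log 2 ≈ 0.693`; `4/5` is a convenient threshold beyond
it. -/
theorem profile_nonneg {u : ℝ} (hu : 4 / 5 ≤ u) : 0 ≤ profile u := by
  have h : Real.exp (-u) < 0.45 :=
    (Real.exp_le_exp.2 (neg_le_neg hu)).trans_lt exp_neg_four_fifths_lt
  rw [profile_eq]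
  have : 0 ≤ 1 - 2 * Real.exp (-u) := by linarith
  positivity

theorem neg_profileDeriv_le {u : ℝ} (hu : 1 ≤ u) : -profileDeriv u ≤ u * Real.exp (-u) := by
  have h1 := Real.exp_pos (-u)
  have h2 : 0 ≤ (4 * u - 2) * Real.exp (-(2 * u)) :=
    mul_nonneg (by linarith) (Real.exp_pos _).le
  unfold profileDeriv
  linarith

theorem profileDeriv_nonpos {u : ℝ} (hu : 5 ≤ u) : profileDeriv u ≤ 0 := by
  have h := exp_neg_le_of_natCast_le 5 (by norm_num) (u := u) (by exact_mod_cast hu)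
  have h' : Real.exp (-u) ≤ 0.0068 := h.trans (by norm_num)
  have hpos := Real.exp_pos (-u)
  rw [profileDeriv, exp_neg_two_mul]
  have : (4 * u - 2) * Real.exp (-u) ≤ (4 * u - 2) * 0.0068 := by gcongr; linarith
  nlinarith

/-- `u e^{-u} ≤ 7 e^{-7}` for `u ≥ 7`. -/
theorem mul_exp_neg_lt {u : ℝ} (hu : 7 ≤ u) : u * Real.exp (-u) < 0.0064 := by
  have h := mul_exp_neg_antitoneOn (a := 7) (b := u) (by simp) (by simp; linarith) hu
  have h7 := exp_neg_natCast_lt 7 (by norm_num)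
  have : ((1 : ℝ) / 2.718) ^ 7 < 0.000914 := by norm_num
  push_cast at h7
  simp only at h
  linarith

/-- Away from the small arguments the profile dominates the six shortest vectors at `u₀`. -/
theorem mul_exp_neg_lt_profile {u₀ t : ℝ} (hu₀ : 7.25 ≤ u₀) (ht : 4 / 5 ≤ t)
    (htu : t ≤ 0.722 * u₀) : 3.05 * (u₀ * Real.exp (-u₀)) < profile t := by
  have hsmall := mul_exp_neg_lt (u := u₀) (by linarith)
  have e1 := exp_neg_natCast_lt 1 (by norm_num)
  have e2 := exp_neg_natCast_lt 2 (by norm_num)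
  have n1 : ((1 : ℝ) / 2.718) ^ 1 < 0.368 := by norm_num
  have n2 : ((1 : ℝ) / 2.718) ^ 2 < 0.1354 := by norm_num
  push_cast at e1 e2
  have l1 : 0.3678 < Real.exp (-1) := by
    rw [Real.exp_neg, lt_inv_comm₀ (by norm_num) (Real.exp_pos _)]
    have := Real.exp_one_lt_d9
    norm_num
    linarith
  have l2 : 0.135 < Real.exp (-2) := by
    have : Real.exp (-2) = Real.exp (-1) ^ 2 := by
      rw [← Real.exp_nat_mul]; norm_num
    rw [this]
    nlinarith
  rw [profile_eq]
  -- The left side is below `3.05 * 0.0064 < 0.02`, so crude bounds suffice for `t ≤ 2`. Beyond 2,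
  -- monotonicity reduces to `t = 0.722 u₀`, and `0.278 * 7.25 > 2` yields a factor `e²`.
  rcases le_or_gt t 1 with h1 | h1
  · have a1 : Real.exp (-1) ≤ Real.exp (-t) := Real.exp_le_exp.2 (by linarith)
    have a2 : Real.exp (-t) < 0.45 :=
      (Real.exp_le_exp.2 (neg_le_neg ht)).trans_lt exp_neg_four_fifths_lt
    have a3 : (4 / 5) * 0.3678 ≤ t * Real.exp (-t) := by gcongr; linarith
    have a4 : (4 / 5) * 0.3678 * (1 - 2 * 0.45) ≤ t * Real.exp (-t) * (1 - 2 * Real.exp (-t)) := by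
      gcongr
    linarith
  rcases le_or_gt t 2 with h2 | h2
  · have a2 : Real.exp (-t) ≤ Real.exp (-1) := Real.exp_le_exp.2 (by linarith)
    have a3 := mul_exp_neg_antitoneOn (a := t) (b := 2) (by simp; linarith) (by simp) h2
    simp only at a3
    have a4 : 0.27 * (1 - 2 * 0.368) ≤ t * Real.exp (-t) * (1 - 2 * Real.exp (-t)) := by
      gcongr <;> linarith
    linarith
  · have a2 : Real.exp (-t) ≤ Real.exp (-2) := Real.exp_le_exp.2 (by linarith)
    have a3 := mul_exp_neg_antitoneOn (a := t) (b := 0.722 * u₀) (by simp; linarith)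
      (by simp only [Set.mem_Ici]; linarith) htu
    simp only at a3
    have a5 : 7.38 ≤ Real.exp (0.278 * u₀) := by
      have : Real.exp 2 ≤ Real.exp (0.278 * u₀) := Real.exp_le_exp.2 (by linarith)
      have h : Real.exp 2 = Real.exp 1 ^ 2 := by rw [← Real.exp_nat_mul]; norm_num
      have := Real.exp_one_gt_d9
      nlinarith
    have a6 : Real.exp (-(0.722 * u₀)) = Real.exp (0.278 * u₀) * Real.exp (-u₀) := by
      rw [← Real.exp_add]; congr 1; ring
    have hp : 0 < u₀ * Real.exp (-u₀) := by positivity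
    have a7 : 5.32 * (u₀ * Real.exp (-u₀)) ≤ t * Real.exp (-t) := by
      rw [a6] at a3
      nlinarith
    have a8 : 5.32 * (u₀ * Real.exp (-u₀)) * (1 - 2 * 0.1354)
        ≤ t * Real.exp (-t) * (1 - 2 * Real.exp (-t)) := by
      gcongr
      linarith
    linarith

/-! ### The hexagonal norm form and sums over the hexagonal lattice. -/

/-- The norm form `m² + mn + n²` of the hexagonal lattice. -/
def hexNorm (p : ℤ × ℤ) : ℝ := (p.1 : ℝ) ^ 2 + p.1 * p.2 + (p.2 : ℝ) ^ 2

/-- The quadratic form `latticeNormSq` at the point `1/2 + iy`. -/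
noncomputable def halfForm (y : ℝ) (p : ℤ × ℤ) : ℝ :=
  ((p.1 : ℝ) / 2 + p.2) ^ 2 / y + (p.1 : ℝ) ^ 2 * y

/-- The six shortest vectors of the hexagonal lattice. -/
def hexUnits : Finset (ℤ × ℤ) := {(0, 1), (0, -1), (1, 0), (-1, 0), (1, -1), (-1, 1)}

theorem hexNorm_nonneg (p : ℤ × ℤ) : 0 ≤ hexNorm p := by
  unfold hexNorm; nlinarith [sq_nonneg ((p.1 : ℝ) + p.2), sq_nonneg (p.1 : ℝ), sq_nonneg (p.2 : ℝ)]

theorem fst_sq_le_hexNorm (p : ℤ × ℤ) : (p.1 : ℝ) ^ 2 ≤ 2 * hexNorm p := by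
  unfold hexNorm; nlinarith [sq_nonneg ((p.1 : ℝ) + p.2), sq_nonneg (p.1 : ℝ), sq_nonneg (p.2 : ℝ)]

theorem natAbs_le_sq (k : ℤ) : ((k.natAbs : ℕ) : ℝ) ≤ (k : ℝ) ^ 2 := by
  have : (k.natAbs : ℤ) ≤ k ^ 2 := by
    rw [← Int.natAbs_sq]; exact_mod_cast Nat.le_self_pow (by norm_num) k.natAbs
  have h' : (((k.natAbs : ℕ) : ℤ) : ℝ) ≤ ((k ^ 2 : ℤ) : ℝ) := Int.cast_le.2 this
  rwa [Int.cast_natCast, Int.cast_pow] at h'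

theorem natAbs_add_natAbs_le_hexNorm (p : ℤ × ℤ) :
    ((p.1.natAbs + p.2.natAbs : ℕ) : ℝ) ≤ 2 * hexNorm p := by
  have h1 := natAbs_le_sq p.1
  have h2 := natAbs_le_sq p.2
  push_cast at *
  unfold hexNorm
  nlinarith [sq_nonneg ((p.1 : ℝ) + p.2)]

/-- The form does not represent 2; norm below 3 forces `|m|, |n| ≤ 1`, a finite check. -/
theorem eq_zero_or_mem_hexUnits_or_three_le (p : ℤ × ℤ) :
    p = 0 ∨ p ∈ hexUnits ∨ 3 ≤ hexNorm p := by
  obtain ⟨m, n⟩ := p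
  by_contra! h
  obtain ⟨h0, h1, h2⟩ := h
  have hk : m ^ 2 + m * n + n ^ 2 < 3 := by
    simp only [hexNorm] at h2; exact_mod_cast h2
  have hm : m ^ 2 < 2 ^ 2 := by nlinarith [sq_nonneg (m + 2 * n)]
  have hn : n ^ 2 < 2 ^ 2 := by nlinarith [sq_nonneg (n + 2 * m)]
  obtain ⟨hm1, hm2⟩ := abs_lt.1 (abs_lt_of_sq_lt_sq hm (by norm_num))
  obtain ⟨hn1, hn2⟩ := abs_lt.1 (abs_lt_of_sq_lt_sq hn (by norm_num))
  interval_cases m <;> interval_cases n <;> first | omega | (exact absurd rfl h0) |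
    (exact absurd (by decide) h1)

theorem hexNorm_of_mem_hexUnits {p : ℤ × ℤ} (hp : p ∈ hexUnits) : hexNorm p = 1 := by
  simp only [hexUnits, Finset.mem_insert, Finset.mem_singleton] at hp
  rcases hp with rfl | rfl | rfl | rfl | rfl | rfl <;> norm_num [hexNorm]

theorem hexNorm_zero : hexNorm 0 = 0 := by simp [hexNorm]

theorem eq_zero_or_one_le_hexNorm (p : ℤ × ℤ) : p = 0 ∨ 1 ≤ hexNorm p := by
  rcases eq_zero_or_mem_hexUnits_or_three_le p with h | h | h
  · exact Or.inl h
  · exact Or.inr (hexNorm_of_mem_hexUnits h).ge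
  · exact Or.inr (by linarith)

theorem hasSum_pow_natAbs {r : ℝ} (h0 : 0 ≤ r) (h1 : r < 1) :
    HasSum (fun n : ℤ => r ^ n.natAbs) ((1 - r)⁻¹ + r * (1 - r)⁻¹) := by
  have hg := hasSum_geometric_of_lt_one h0 h1
  refine HasSum.of_nat_of_neg_add_one (by simpa using hg) ?_
  have hn (n : ℕ) : r ^ (-((n : ℤ) + 1)).natAbs = r * r ^ n := by
    rw [← pow_succ']
    congr 1
  simpa only [hn] using hg.mul_left r

theorem hasSum_pow_natAbs_mul {r : ℝ} (h0 : 0 ≤ r) (h1 : r < 1) :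
    HasSum (fun p : ℤ × ℤ => r ^ (p.1.natAbs + p.2.natAbs))
      (((1 - r)⁻¹ + r * (1 - r)⁻¹) ^ 2) := by
  have h := hasSum_pow_natAbs h0 h1
  have hs := h.summable.mul_of_nonneg h.summable (fun n => by positivity) (fun n => by positivity)
  have := h.mul h hs
  simpa only [pow_add, ← pow_two] using this

/-- The majorant used for sums over the hexagonal lattice. -/
noncomputable def hexMajorant (p : ℤ × ℤ) : ℝ :=
  (if p ∈ hexUnits then 1 else 0)
    + 2 * Real.exp (-5) * Real.exp (-1) ^ (p.1.natAbs + p.2.natAbs)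

theorem hasSum_hexMajorant : ∃ s < 6.1, HasSum hexMajorant s := by
  have e1 := exp_neg_natCast_lt 1 (by norm_num)
  have e5 := exp_neg_natCast_lt 5 (by norm_num)
  have n1 : ((1 : ℝ) / 2.718) ^ 1 < 0.368 := by norm_num
  have n5 : ((1 : ℝ) / 2.718) ^ 5 < 0.0068 := by norm_num
  push_cast at e1 e5
  have h1 : HasSum (fun p : ℤ × ℤ => if p ∈ hexUnits then (1 : ℝ) else 0) 6 := by
    have : ∑ p ∈ hexUnits, (if p ∈ hexUnits then (1 : ℝ) else 0) = 6 := by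
      rw [Finset.sum_ite_mem, Finset.inter_self, Finset.sum_const]
      have : hexUnits.card = 6 := by decide
      simp [this]
    rw [← this]
    exact hasSum_sum_of_ne_finset_zero (fun p hp => by simp [hp])
  have h2 := (hasSum_pow_natAbs_mul (Real.exp_pos (-1)).le (by linarith)).mul_left
    (2 * Real.exp (-5))
  refine ⟨_, ?_, h1.add h2⟩
  have hinv : (1 - Real.exp (-1))⁻¹ ≤ 1.6 := by
    rw [inv_le_comm₀ (by linarith) (by norm_num)]
    norm_num
    linarith
  have hpos := Real.exp_pos (-1)
  have hpos5 := Real.exp_pos (-5)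
  have hinv0 : 0 ≤ (1 - Real.exp (-1))⁻¹ := inv_nonneg.2 (by linarith)
  have : 2 * Real.exp (-5) * ((1 - Real.exp (-1))⁻¹ + Real.exp (-1) * (1 - Real.exp (-1))⁻¹) ^ 2
      ≤ 2 * 0.0068 * (1.6 + 0.368 * 1.6) ^ 2 := by
    gcongr <;> linarith
  norm_num at this ⊢
  linarith

/-- For `N ≥ 3`, use `N² ≤ 2 e^N` and `|m| + |n| ≤ 2N`; what remains is `(u - 3) N ≥ u + 5`, which
at `N = 3` is exactly `u ≥ 7`. The weight `N²` lets the same sum control both the energy and the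
linear term at the hexagonal point. -/
theorem sq_hexNorm_mul_exp_le {u : ℝ} (hu : 7 ≤ u) (p : ℤ × ℤ) :
    hexNorm p ^ 2 * Real.exp (-(u * hexNorm p)) ≤ Real.exp (-u) * hexMajorant p := by
  have hpos : 0 ≤ 2 * Real.exp (-5) * Real.exp (-1) ^ (p.1.natAbs + p.2.natAbs) := by positivity
  rcases eq_zero_or_mem_hexUnits_or_three_le p with h | h | h
  · subst h
    rw [hexNorm_zero]
    simp [hexMajorant, hexUnits]
    positivity
  · rw [hexNorm_of_mem_hexUnits h, hexMajorant, if_pos h]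
    rw [mul_one, one_pow, one_mul]
    nlinarith [Real.exp_pos (-u)]
  · have hk := natAbs_add_natAbs_le_hexNorm p
    have h1 : hexNorm p ^ 2 ≤ 2 * Real.exp (hexNorm p) := by
      have := Real.pow_div_factorial_le_exp (hexNorm p) (by linarith) 2
      norm_num [Nat.factorial] at this
      linarith
    have h2 : Real.exp (hexNorm p) * Real.exp (-(u * hexNorm p)) ≤
        Real.exp (-u) * (Real.exp (-5) * Real.exp (-1) ^ (p.1.natAbs + p.2.natAbs)) := by
      rw [← Real.exp_nat_mul, ← Real.exp_add, ← Real.exp_add, ← Real.exp_add, Real.exp_le_exp]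
      nlinarith
    have h3 : 0 ≤ (if p ∈ hexUnits then (1 : ℝ) else 0) := by split_ifs <;> norm_num
    calc _ ≤ 2 * Real.exp (hexNorm p) * Real.exp (-(u * hexNorm p)) := by gcongr
      _ = 2 * (Real.exp (hexNorm p) * Real.exp (-(u * hexNorm p))) := by ring
      _ ≤ 2 * (Real.exp (-u) * (Real.exp (-5) * Real.exp (-1) ^ (p.1.natAbs + p.2.natAbs))) := by
        gcongr
      _ = Real.exp (-u) * (2 * Real.exp (-5) * Real.exp (-1) ^ (p.1.natAbs + p.2.natAbs)) := by
        ring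
      _ ≤ _ := by
        unfold hexMajorant
        gcongr
        linarith

theorem summable_sq_hexNorm_mul_exp {u : ℝ} (hu : 7 ≤ u) :
    Summable fun p => hexNorm p ^ 2 * Real.exp (-(u * hexNorm p)) := by
  obtain ⟨s, -, hs⟩ := hasSum_hexMajorant
  exact (hs.summable.mul_left _).of_nonneg_of_le (fun p => by positivity)
    (sq_hexNorm_mul_exp_le hu)

theorem tsum_sq_hexNorm_mul_exp_le {u : ℝ} (hu : 7 ≤ u) :
    ∑' p, hexNorm p ^ 2 * Real.exp (-(u * hexNorm p)) ≤ 6.1 * Real.exp (-u) := by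
  obtain ⟨s, hs6, hs⟩ := hasSum_hexMajorant
  have := (summable_sq_hexNorm_mul_exp hu).tsum_le_tsum (sq_hexNorm_mul_exp_le hu)
    (hs.summable.mul_left _)
  rw [tsum_mul_left, hs.tsum_eq] at this
  nlinarith [Real.exp_pos (-u)]

/-! ### The quadratic form and the energy on the line `Re z = 1/2`. -/

theorem halfForm_eq {y : ℝ} (hy : 0 < y) (p : ℤ × ℤ) :
    halfForm y p = hexNorm p / y + (p.1 : ℝ) ^ 2 * ((y ^ 2 - 3 / 4) / y) := by
  unfold halfForm hexNorm
  field_simp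
  ring

theorem hexNorm_div_le_halfForm {y : ℝ} (hy : Real.sqrt 3 / 2 ≤ y) (p : ℤ × ℤ) :
    hexNorm p / y ≤ halfForm y p := by
  have h3 := Real.sq_sqrt (show (0 : ℝ) ≤ 3 by norm_num)
  have h3' : 0 < Real.sqrt 3 := by positivity
  have hy0 : 0 < y := by linarith
  rw [halfForm_eq hy0]
  have : 0 ≤ y ^ 2 - 3 / 4 := by nlinarith
  have : 0 ≤ (p.1 : ℝ) ^ 2 * ((y ^ 2 - 3 / 4) / y) := by positivity
  linarith

theorem halfForm_sqrt_three_div_two (p : ℤ × ℤ) :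
    halfForm (Real.sqrt 3 / 2) p = 2 / Real.sqrt 3 * hexNorm p := by
  have h3 := Real.sq_sqrt (show (0 : ℝ) ≤ 3 by norm_num)
  have h3' : 0 < Real.sqrt 3 := by positivity
  rw [halfForm_eq (by positivity), div_pow, h3]
  field_simp
  ring

theorem latticeNormSq_eq_halfForm {z : ℍ} (hz : z.re = 1 / 2) (p : ℤ × ℤ) :
    latticeNormSq z p = halfForm z.im p := by
  have him := z.im_pos
  unfold latticeNormSq halfForm
  rw [← Complex.normSq_eq_norm_sq, Complex.normSq_apply]
  have h1 : ((p.1 : ℂ) * (z : ℂ) + (p.2 : ℂ)).re = p.1 / 2 + p.2 := by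
    simp [hz]; ring
  have h2 : ((p.1 : ℂ) * (z : ℂ) + (p.2 : ℂ)).im = p.1 * z.im := by
    simp
  rw [h1, h2]
  field_simp

theorem profile_mul_eq (α q : ℝ) : profile (Real.pi * α * q)
    = Real.pi * α * (q * Real.exp (-Real.pi * α * q)
      - 2 * (q * Real.exp (-Real.pi * (2 * α) * q))) := by
  unfold profile
  rw [show -(Real.pi * α * q) = -Real.pi * α * q by ring,
    show -(2 * (Real.pi * α * q)) = -Real.pi * (2 * α) * q by ring]
  ring

theorem hasSum_profile_latticeNormSq {α : ℝ} (hα : 0 < α) (z : ℍ) :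
    HasSum (fun p => profile (Real.pi * α * latticeNormSq z p))
      (Real.pi * α * (latticeK α z - 2 * latticeK (2 * α) z)) := by
  simp only [profile_mul_eq]
  exact ((summable_latticeK hα z).hasSum.sub
    ((summable_latticeK (by linarith : 0 < 2 * α) z).hasSum.mul_left 2)).mul_left _

/-- The lattice energy of `profile` at `1/2 + iy`. -/
noncomputable def halfEnergy (c y : ℝ) : ℝ := ∑' p : ℤ × ℤ, profile (c * halfForm y p)

theorem halfEnergy_eq {α : ℝ} (hα : 0 < α) {z : ℍ} (hz : z.re = 1 / 2) :
    halfEnergy (Real.pi * α) z.im = Real.pi * α * (latticeK α z - 2 * latticeK (2 * α) z) := by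
  have := (hasSum_profile_latticeNormSq hα z).tsum_eq
  simp only [latticeNormSq_eq_halfForm hz] at this
  exact this

theorem summable_profile_halfForm {c y : ℝ} (hc : 0 < c) (hy : 0 < y) :
    Summable fun p : ℤ × ℤ => profile (c * halfForm y p) := by
  let z : ℍ := ⟨⟨1 / 2, y⟩, hy⟩
  have h := (hasSum_profile_latticeNormSq (div_pos hc Real.pi_pos) z).summable
  have hz : z.re = 1 / 2 := rfl
  simp only [latticeNormSq_eq_halfForm hz, mul_div_cancel₀ c Real.pi_ne_zero] at h
  exact h

theorem halfEnergy_hex_le {c : ℝ} (hc : 7 ≤ 2 / Real.sqrt 3 * c) :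
    halfEnergy c (Real.sqrt 3 / 2)
      ≤ 6.1 * (2 / Real.sqrt 3 * c * Real.exp (-(2 / Real.sqrt 3 * c))) := by
  have h3' : 0 < Real.sqrt 3 := by positivity
  have hc0 : 0 < c := pos_of_mul_pos_right (by linarith) (by positivity : 0 ≤ 2 / Real.sqrt 3)
  have hsum := summable_profile_halfForm hc0 (by positivity : 0 < Real.sqrt 3 / 2)
  have heq (p) : c * halfForm (Real.sqrt 3 / 2) p = 2 / Real.sqrt 3 * c * hexNorm p := by
    rw [halfForm_sqrt_three_div_two]; ring
  unfold halfEnergy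
  simp only [heq] at hsum ⊢
  set u := 2 / Real.sqrt 3 * c
  have h1 := hsum.tsum_le_tsum (g := fun p => u * (hexNorm p ^ 2 * Real.exp (-(u * hexNorm p))))
    (fun p => by
      refine (profile_le (mul_nonneg (by linarith) (hexNorm_nonneg p))).trans ?_
      rw [mul_assoc]
      have : hexNorm p ≤ hexNorm p ^ 2 := by
        rcases eq_zero_or_one_le_hexNorm p with h | h
        · simp [h, hexNorm_zero]
        · nlinarith
      gcongr) ((summable_sq_hexNorm_mul_exp hc).mul_left _)
  rw [tsum_mul_left] at h1
  have := tsum_sq_hexNorm_mul_exp_le hc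
  nlinarith

/-! ### Rotation averaging and the linear term. -/

/-- The rotation of order six of the hexagonal lattice. -/
def hexRotation : ℤ × ℤ ≃ ℤ × ℤ where
  toFun p := (-p.2, p.1 + p.2)
  invFun p := (p.1 + p.2, -p.1)
  left_inv p := by ext <;> simp
  right_inv p := by ext <;> simp

theorem hexNorm_hexRotation (p : ℤ × ℤ) : hexNorm (hexRotation p) = hexNorm p := by
  simp [hexNorm, hexRotation]; ring

/-- Up to sign an orbit has three vectors, and a rotation-invariant quadratic form is a multiple of
`hexNorm`. The multiple `2y + 3/(2y)` is minimal at `y = √3/2`, hence the square on the right. -/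
theorem halfForm_add_hexRotation {y : ℝ} (hy : 0 < y) (p : ℤ × ℤ) :
    halfForm y p + halfForm y (hexRotation p) + halfForm y (hexRotation (hexRotation p))
      - 3 * (2 / Real.sqrt 3 * hexNorm p)
      = 2 / y * (y - Real.sqrt 3 / 2) ^ 2 * hexNorm p := by
  have h3 := Real.sq_sqrt (show (0 : ℝ) ≤ 3 by norm_num)
  have h3' : 0 < Real.sqrt 3 := by positivity
  have hdiv : 2 / Real.sqrt 3 = 2 / 3 * Real.sqrt 3 := by field_simp; linarith
  rw [hdiv, sub_sq, div_pow, h3]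
  simp [halfForm, hexNorm, hexRotation]
  field_simp
  ring

/-- A sum weighted by a function of `hexNorm` only sees the rotation average of `halfForm`. -/
theorem tsum_mul_halfForm_sub {y c : ℝ} (hy : 0 < y) (D : ℝ → ℝ)
    (hs : Summable fun p => D (hexNorm p) * (c * halfForm y p
      - 2 / Real.sqrt 3 * c * hexNorm p)) :
    ∑' p, D (hexNorm p) * (c * halfForm y p - 2 / Real.sqrt 3 * c * hexNorm p)
      = 2 * c / (3 * y) * (y - Real.sqrt 3 / 2) ^ 2 * ∑' p, D (hexNorm p) * hexNorm p := by
  set X : ℤ × ℤ → ℝ := fun p => D (hexNorm p) * (c * halfForm y p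
      - 2 / Real.sqrt 3 * c * hexNorm p) with hX
  have h1 : HasSum X (∑' p, X p) := hs.hasSum
  have h2 : HasSum (fun p => X (hexRotation p)) (∑' p, X p) := (hexRotation.hasSum_iff).2 h1
  have h3 : HasSum (fun p => X (hexRotation (hexRotation p))) (∑' p, X p) :=
    (hexRotation.hasSum_iff).2 h2
  have h := ((h1.add h2).add h3).mul_left (1 / 3)
  rw [← tsum_mul_left]
  have h4 : 1 / 3 * (∑' p, X p + ∑' p, X p + ∑' p, X p) = ∑' p, X p := by ring
  rw [h4] at h
  refine h.tsum_eq.symm.trans (tsum_congr fun p => ?_)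
  have := halfForm_add_hexRotation hy p
  simp only [hX, hexNorm_hexRotation]
  linear_combination (c / 3 * D (hexNorm p)) * this

theorem summable_of_abs_le_hexNorm {u C : ℝ} (hu : 7 ≤ u) {X : ℤ × ℤ → ℝ}
    (hX : ∀ p, |X p| ≤ C * hexNorm p) :
    Summable fun p => profileDeriv (u * hexNorm p) * X p := by
  refine ((summable_sq_hexNorm_mul_exp hu).mul_left (u * C)).of_norm_bounded (fun p => ?_)
  have hp := hX p
  rw [norm_mul, Real.norm_eq_abs, Real.norm_eq_abs]
  rcases eq_zero_or_one_le_hexNorm p with h | h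
  · subst h
    rw [hexNorm_zero, mul_zero] at hp
    simp [abs_nonpos_iff.1 hp, hexNorm_zero]
  · have hN : 5 ≤ u * hexNorm p := by nlinarith
    rw [abs_of_nonpos (profileDeriv_nonpos hN)]
    calc _ ≤ (u * hexNorm p * Real.exp (-(u * hexNorm p))) * (C * hexNorm p) := by
          gcongr
          exact neg_profileDeriv_le (by linarith)
      _ = _ := by ring

theorem le_tsum_profileDeriv_mul_hexNorm {u : ℝ} (hu : 7 ≤ u) :
    -(6.1 * (u * Real.exp (-u))) ≤ ∑' p, profileDeriv (u * hexNorm p) * hexNorm p := by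
  have hs : Summable fun p => profileDeriv (u * hexNorm p) * hexNorm p :=
    summable_of_abs_le_hexNorm (C := 1) hu
      (fun p => by rw [abs_of_nonneg (hexNorm_nonneg p), one_mul])
  have hm := ((summable_sq_hexNorm_mul_exp hu).mul_left (-u)).tsum_le_tsum (fun p => by
    show _ ≤ profileDeriv (u * hexNorm p) * hexNorm p
    rcases eq_zero_or_one_le_hexNorm p with h | h
    · simp [h, hexNorm_zero]
    · have := neg_profileDeriv_le (u := u * hexNorm p) (by nlinarith)
      nlinarith) hs
  rw [tsum_mul_left] at hm
  have := tsum_sq_hexNorm_mul_exp_le hu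
  nlinarith

/-! ### The range `y ≤ 6/5`: tangents and convexity gain. -/

theorem sqrt_three_mem : 1.732 < Real.sqrt 3 ∧ Real.sqrt 3 < 1.7321 :=
  ⟨Real.lt_sqrt_of_sq_lt (by norm_num), (Real.sqrt_lt' (by norm_num)).2 (by norm_num)⟩

theorem two_div_sqrt_three_mul_ge {c : ℝ} (hc : 6.28 ≤ c) : 7.25 ≤ 2 / Real.sqrt 3 * c := by
  obtain ⟨h1, h2⟩ := sqrt_three_mem
  rw [div_mul_eq_mul_div, le_div_iff₀ (by linarith)]
  nlinarith

/-- A crude bound, needed only for the summability of the linear terms. -/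
theorem abs_mul_halfForm_sub_le {c y u : ℝ} (hc : 0 < c) (hu : 0 ≤ u)
    (hy : Real.sqrt 3 / 2 < y) (hcu : c / y ≤ u) (p : ℤ × ℤ) :
    |c * halfForm y p - u * hexNorm p|
      ≤ (u + 2 * (c * ((y ^ 2 - 3 / 4) / y))) * hexNorm p := by
  obtain ⟨hs1, hs2⟩ := sqrt_three_mem
  have hy0 : 0 < y := by linarith
  have hN := hexNorm_nonneg p
  have hX0 : 0 ≤ c * ((y ^ 2 - 3 / 4) / y) := by
    have := Real.sq_sqrt (show (0 : ℝ) ≤ 3 by norm_num)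
    have : 0 ≤ y ^ 2 - 3 / 4 := by nlinarith
    positivity
  have : c * halfForm y p - u * hexNorm p
      = (c / y - u) * hexNorm p + c * ((y ^ 2 - 3 / 4) / y) * (p.1 : ℝ) ^ 2 := by
    rw [halfForm_eq hy0]; ring
  rw [this]
  generalize c * ((y ^ 2 - 3 / 4) / y) = b at hX0
  have h1 : 0 ≤ (u - c / y) * hexNorm p := mul_nonneg (by linarith) hN
  have h2 : 0 ≤ b * (p.1 : ℝ) ^ 2 := by positivity
  have h3 : b * (p.1 : ℝ) ^ 2 ≤ b * (2 * hexNorm p) := by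
    gcongr; exact fst_sq_le_hexNorm p
  have h4 : 0 ≤ c / y * hexNorm p := by positivity
  have h5 : 0 ≤ u * hexNorm p := mul_nonneg hu hN
  have h6 : 0 ≤ b * hexNorm p := mul_nonneg hX0 hN
  rw [abs_le]
  constructor <;> linarith

theorem div_sub_two_div_sqrt_three_mul {y : ℝ} (hy : 0 < y) (c : ℝ) :
    2 / Real.sqrt 3 * c - c / y = c * (2 / Real.sqrt 3) / y * (y - Real.sqrt 3 / 2) := by
  have h3' : 0 < Real.sqrt 3 := by positivity
  field_simp

theorem sq_div_sub_two_div_sqrt_three_mul {y : ℝ} (hy : 0 < y) (c : ℝ) :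
    (c / y - 2 / Real.sqrt 3 * c) ^ 2
      = c ^ 2 * (4 / 3) / y ^ 2 * (y - Real.sqrt 3 / 2) ^ 2 := by
  have h3 := Real.sq_sqrt (show (0 : ℝ) ≤ 3 by norm_num)
  rw [← neg_sq, neg_sub, div_sub_two_div_sqrt_three_mul hy, mul_pow, div_pow, mul_pow, div_pow, h3]
  ring

/-- The convexity gain of the two vectors that shorten beats the linear loss of all vectors. -/
theorem near_gain_pos {c y M : ℝ} (hc : 6.28 ≤ c) (hy : Real.sqrt 3 / 2 < y) (hy' : y ≤ 6 / 5)
    {u : ℝ} (hu_def : u = 2 / Real.sqrt 3 * c)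
    (hM : -(6.1 * (u * Real.exp (-u))) ≤ M) :
    0 < 2 * c / (3 * y) * (y - Real.sqrt 3 / 2) ^ 2 * M
      + 2 * (9 / 20 * ((u - 2) * Real.exp (-u)) * (c / y - u) ^ 2) := by
  obtain ⟨hs1, hs2⟩ := sqrt_three_mem
  have hu : 7.25 ≤ u := hu_def ▸ two_div_sqrt_three_mul_ge hc
  have hy0 : 0 < y := by linarith
  have hc0 : 0 < c := by linarith
  have hcu : c = Real.sqrt 3 / 2 * u := by rw [hu_def]; field_simp
  have hsq : (c / y - u) ^ 2 = _ := hu_def ▸ sq_div_sub_two_div_sqrt_three_mul hy0 c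
  rw [hsq]
  have hE0 : 0 < Real.exp (-u) := Real.exp_pos _
  have hδ0 : 0 < (y - Real.sqrt 3 / 2) ^ 2 := by
    have : 0 < y - Real.sqrt 3 / 2 := by linarith
    positivity
  generalize Real.exp (-u) = E at *
  generalize (y - Real.sqrt 3 / 2) ^ 2 = δ at *
  -- Here `c / y ≥ (√3/2) u / 1.2`. After factoring out `2c/(3y) · δ`, the claim reduces to `h3`,
  -- which holds since `9/5 * 5.25 * 0.72 > 6.1`.
  have h1 : 0.72 * u ≤ c / y := by
    rw [le_div_iff₀ hy0]
    nlinarith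
  have h3 : 6.1 < 9 / 5 * (u - 2) * 0.72 := by linarith
  have h4 : 0 < u * E := mul_pos (by linarith) hE0
  have h0 : 0 ≤ u - 2 := by linarith
  have h2 : 9 / 5 * (u - 2) * E * (0.72 * u) ≤ 9 / 5 * (u - 2) * E * (c / y) := by
    gcongr
  have h5 : 6.1 * (u * E) < 9 / 5 * (u - 2) * 0.72 * (u * E) := by gcongr
  have hpos : 0 < 2 * c / (3 * y) * δ * (M + 9 / 5 * (u - 2) * E * (c / y)) :=
    mul_pos (by positivity) (by linarith)
  refine hpos.trans_eq ?_
  field_simp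
  ring

/-- Every nonzero vector has argument at least `c / y ≥ 5`, inside the convex range. The quadratic
gain is kept only for `(0, ±1)`; at the origin both sides vanish. -/
theorem le_profile_halfForm {c y u : ℝ} (hc : 0 < c) (hy : Real.sqrt 3 / 2 ≤ y)
    (htc : 5 ≤ c / y) (htu : c / y ≤ u) (p : ℤ × ℤ) :
    profile (u * hexNorm p) + profileDeriv (u * hexNorm p) * (c * halfForm y p - u * hexNorm p)
      + (if p ∈ ({(0, 1), (0, -1)} : Finset (ℤ × ℤ)) then
          9 / 20 * ((u - 2) * Real.exp (-u)) * (c / y - u) ^ 2 else 0)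
      ≤ profile (c * halfForm y p) := by
  obtain ⟨hs1, hs2⟩ := sqrt_three_mem
  have hy0 : 0 < y := by linarith
  rcases eq_zero_or_one_le_hexNorm p with h | h
  · subst h
    rw [if_neg (by decide)]
    simp [halfForm, hexNorm]
  by_cases hp : p ∈ ({(0, 1), (0, -1)} : Finset (ℤ × ℤ))
  · have hN : hexNorm p = 1 ∧ halfForm y p = 1 / y := by
      simp only [Finset.mem_insert, Finset.mem_singleton] at hp
      rcases hp with rfl | rfl <;> norm_num [hexNorm, halfForm]
    have := profile_tangent_add_sq_le htc htu
    rw [if_pos hp, hN.1, hN.2, mul_one, mul_one_div]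
    linarith
  · rw [if_neg hp]
    have h1 := hexNorm_div_le_halfForm hy p
    have h2 : 1 / y ≤ hexNorm p / y := by gcongr
    have h3 : c * (1 / y) ≤ c * halfForm y p := by gcongr; linarith
    rw [mul_one_div] at h3
    have := profile_tangent_le (u₀ := u * hexNorm p) (u := c * halfForm y p) (by nlinarith)
      (by linarith)
    linarith

theorem halfEnergy_lt_of_le {c y : ℝ} (hc : 6.28 ≤ c) (hy : Real.sqrt 3 / 2 < y)
    (hy' : y ≤ 6 / 5) : halfEnergy c (Real.sqrt 3 / 2) < halfEnergy c y := by
  obtain ⟨hs1, hs2⟩ := sqrt_three_mem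
  have hu := two_div_sqrt_three_mul_ge hc
  have hy0 : 0 < y := by linarith
  have hc0 : 0 < c := by linarith
  have htc : 5 ≤ c / y := by rw [le_div_iff₀ hy0]; linarith
  have htu : c / y ≤ 2 / Real.sqrt 3 * c := by
    have : 0 ≤ c * (2 / Real.sqrt 3) / y * (y - Real.sqrt 3 / 2) :=
      mul_nonneg (by positivity) (by linarith)
    have := div_sub_two_div_sqrt_three_mul hy0 c
    linarith
  have hs0 := summable_profile_halfForm hc0 (by positivity : 0 < Real.sqrt 3 / 2)
  have hsy := summable_profile_halfForm hc0 hy0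
  have heq (p) : c * halfForm (Real.sqrt 3 / 2) p = 2 / Real.sqrt 3 * c * hexNorm p := by
    rw [halfForm_sqrt_three_div_two]; ring
  have hsX := summable_of_abs_le_hexNorm (u := 2 / Real.sqrt 3 * c) (by linarith)
    (abs_mul_halfForm_sub_le hc0 (by linarith) hy htu)
  have hL := tsum_mul_halfForm_sub hy0 (fun N => profileDeriv (2 / Real.sqrt 3 * c * N)) hsX
  have hgain := near_gain_pos hc hy hy' rfl
    (le_tsum_profileDeriv_mul_hexNorm (u := 2 / Real.sqrt 3 * c) (by linarith))
  have hpt := le_profile_halfForm hc0 hy.le htc htu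
  unfold halfEnergy
  simp only [heq] at hs0 ⊢
  generalize 2 / Real.sqrt 3 * c = u at *
  generalize 9 / 20 * ((u - 2) * Real.exp (-u)) * (c / y - u) ^ 2 = κ at *
  have hextra : HasSum (fun p : ℤ × ℤ => if p ∈ ({(0, 1), (0, -1)} : Finset (ℤ × ℤ))
      then κ else 0) (2 * κ) := by
    have h : HasSum (fun p : ℤ × ℤ => if p ∈ ({(0, 1), (0, -1)} : Finset (ℤ × ℤ))
        then κ else 0) (∑ p ∈ ({(0, 1), (0, -1)} : Finset (ℤ × ℤ)),
          if p ∈ ({(0, 1), (0, -1)} : Finset (ℤ × ℤ)) then κ else 0) :=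
      hasSum_sum_of_ne_finset_zero (fun p hp => if_neg hp)
    rwa [Finset.sum_pair (by decide), if_pos (by decide), if_pos (by decide), ← two_mul] at h
  have hmain := ((hs0.add hsX).add hextra.summable).tsum_le_tsum hpt hsy
  rw [(hs0.add hsX).tsum_add hextra.summable, hs0.tsum_add hsX, hextra.tsum_eq, hL] at hmain
  linarith

/-! ### The range `y ≥ 6/5`, `c/y ≥ 4/5`: two vectors suffice. -/

theorem profile_halfForm_nonneg {c y : ℝ} (hc : 0 < c) (hy : Real.sqrt 3 / 2 ≤ y)
    (ht : 4 / 5 ≤ c / y) (p : ℤ × ℤ) : 0 ≤ profile (c * halfForm y p) := by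
  obtain ⟨hs1, hs2⟩ := sqrt_three_mem
  have hy0 : 0 < y := by linarith
  rcases eq_zero_or_one_le_hexNorm p with h | h
  · simp [h, halfForm, profile]
  · have h1 := hexNorm_div_le_halfForm hy p
    have h2 : 1 / y ≤ hexNorm p / y := by gcongr
    have h3 : c * (1 / y) ≤ c * halfForm y p := by gcongr; linarith
    rw [mul_one_div] at h3
    exact profile_nonneg (ht.trans h3)

theorem halfEnergy_lt_of_ge {c y : ℝ} (hc : 6.28 ≤ c) (hy : 6 / 5 ≤ y)
    (ht : 4 / 5 ≤ c / y) : halfEnergy c (Real.sqrt 3 / 2) < halfEnergy c y := by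
  obtain ⟨hs1, hs2⟩ := sqrt_three_mem
  have hu := two_div_sqrt_three_mul_ge hc
  have hy0 : 0 < y := by linarith
  have hc0 : 0 < c := by linarith
  have hcu : c = Real.sqrt 3 / 2 * (2 / Real.sqrt 3 * c) := by field_simp
  have h0 := halfEnergy_hex_le (c := c) (by linarith)
  have hsum := (summable_profile_halfForm hc0 hy0).sum_le_tsum {(0, 1), (0, -1)}
    (fun p _ => profile_halfForm_nonneg hc0 (by linarith) ht p)
  rw [Finset.sum_pair (by decide)] at hsum
  simp only [halfForm, Int.cast_zero, Int.cast_one, Int.cast_neg] at hsum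
  norm_num at hsum
  rw [← div_eq_mul_inv] at hsum
  -- The constant is `(√3/2) / (6/5) ≈ 0.7217`, rounded up.
  have htu : c / y ≤ 0.722 * (2 / Real.sqrt 3 * c) := by
    rw [div_le_iff₀ hy0]
    nlinarith
  have := mul_exp_neg_lt_profile hu ht htu
  unfold halfEnergy at h0 ⊢
  norm_num at this h0 ⊢
  simp only [halfForm] at *
  linarith

/-! ### The range `c/y ≤ 4/5`: Poisson summation on the row `m = 0`. -/

/-- The Gaussian theta function `∑ exp(-s n²)`. -/
noncomputable def gaussTheta (s : ℝ) : ℝ := ∑' n : ℤ, Real.exp (-(s * (n : ℝ) ^ 2))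

theorem exp_neg_mul_sq_le {s : ℝ} (hs : 0 < s) (n : ℤ) :
    Real.exp (-(s * (n : ℝ) ^ 2)) ≤ Real.exp (-s) ^ n.natAbs := by
  rw [← Real.exp_nat_mul, Real.exp_le_exp]
  have h := natAbs_le_sq n
  nlinarith

theorem summable_gaussTheta {s : ℝ} (hs : 0 < s) :
    Summable fun n : ℤ => Real.exp (-(s * (n : ℝ) ^ 2)) :=
  (hasSum_pow_natAbs (Real.exp_pos _).le (Real.exp_lt_one_iff.2 (by linarith))).summable.of_nonneg_of_le
    (fun _ => (Real.exp_pos _).le) (exp_neg_mul_sq_le hs)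

theorem one_le_gaussTheta {s : ℝ} (hs : 0 < s) : 1 ≤ gaussTheta s := by
  have := (summable_gaussTheta hs).sum_le_tsum {0} (fun _ _ => (Real.exp_pos _).le)
  simpa [gaussTheta] using this

theorem gaussTheta_le {s : ℝ} (hs : 7 ≤ s) : gaussTheta s ≤ 1.002 := by
  have hlt : Real.exp (-s) < 1 := Real.exp_lt_one_iff.2 (by linarith)
  have hg := hasSum_pow_natAbs (Real.exp_pos (-s)).le hlt
  have h := (summable_gaussTheta (by linarith : 0 < s)).tsum_le_tsum
    (exp_neg_mul_sq_le (by linarith)) hg.summable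
  rw [hg.tsum_eq] at h
  have h7 := exp_neg_le_of_natCast_le 7 (by norm_num) (u := s) (by exact_mod_cast hs)
  have h7' : Real.exp (-s) ≤ 0.000914 := h7.trans (by norm_num)
  refine h.trans ?_
  rw [← one_add_mul, ← div_eq_mul_inv, div_le_iff₀ (by linarith)]
  linarith

theorem gaussTheta_eq {s : ℝ} (hs : 0 < s) :
    gaussTheta s = Real.sqrt (Real.pi / s) * gaussTheta (Real.pi ^ 2 / s) := by
  have hpi := Real.pi_pos
  have h := Real.tsum_exp_neg_mul_int_sq (div_pos hs hpi)
  have h1 (n : ℤ) : -Real.pi * (s / Real.pi) * (n : ℝ) ^ 2 = -(s * (n : ℝ) ^ 2) := by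
    field_simp
  have h2 (n : ℤ) : -Real.pi / (s / Real.pi) * (n : ℝ) ^ 2
      = -(Real.pi ^ 2 / s * (n : ℝ) ^ 2) := by
    field_simp
  simp only [h1, h2] at h
  unfold gaussTheta
  rw [h, ← Real.sqrt_eq_rpow, one_div, ← Real.sqrt_inv, inv_div]

theorem le_gaussTheta {s : ℝ} (hs : 0 < s) : Real.sqrt (Real.pi / s) ≤ gaussTheta s := by
  rw [gaussTheta_eq hs]
  have hpi := Real.pi_pos
  exact le_mul_of_one_le_right (Real.sqrt_nonneg _) (one_le_gaussTheta (by positivity))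

/-- The dual parameter satisfies `π²/s ≥ π²/1.4 > 7`, so the dual theta sum is almost 1. -/
theorem gaussTheta_le_mul {s : ℝ} (hs : 0 < s) (hs' : s ≤ 1.4) :
    gaussTheta s ≤ Real.sqrt (Real.pi / s) * 1.002 := by
  rw [gaussTheta_eq hs]
  gcongr
  apply gaussTheta_le
  rw [le_div_iff₀ hs]
  nlinarith [Real.pi_gt_d2]

/-- A difference-quotient lower bound for `profile`. -/
theorem le_profile (x : ℝ) : (Real.exp (-x) - Real.exp (-(1.1025 * x))) / 0.1025
    - (Real.exp (-(2 / 1.21 * x)) - Real.exp (-(2 * x))) / (0.21 / 1.21) ≤ profile x := by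
  -- Convexity of `s ↦ e^{-sx}` compares its slopes at 1 and 2 with a forward and a backward
  -- difference quotient. Summed over `x = t n²`, these become differences of theta values.
  have h1 : Real.exp (-x) * (1 - 0.1025 * x) ≤ Real.exp (-(1.1025 * x)) := by
    have h := Real.add_one_le_exp (-(0.1025 * x))
    have : Real.exp (-(1.1025 * x)) = Real.exp (-x) * Real.exp (-(0.1025 * x)) := by
      rw [← Real.exp_add]; congr 1; ring
    rw [this]
    gcongr
    linarith
  have h2 : Real.exp (-(2 * x)) * (1 + 2 * (0.21 / 1.21) * x) ≤ Real.exp (-(2 / 1.21 * x)) := by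
    have h := Real.add_one_le_exp (2 * (0.21 / 1.21) * x)
    have : Real.exp (-(2 / 1.21 * x)) = Real.exp (-(2 * x)) * Real.exp (2 * (0.21 / 1.21) * x) := by
      rw [← Real.exp_add]; congr 1; ring
    rw [this]
    gcongr
    linarith
  have h3 : (Real.exp (-x) - Real.exp (-(1.1025 * x))) / 0.1025 ≤ x * Real.exp (-x) := by
    rw [div_le_iff₀ (by norm_num)]; linarith
  have h4 : 2 * x * Real.exp (-(2 * x))
      ≤ (Real.exp (-(2 / 1.21 * x)) - Real.exp (-(2 * x))) / (0.21 / 1.21) := by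
    rw [le_div_iff₀ (by norm_num)]; linarith
  unfold profile
  linarith

theorem sqrt_pi_div_mul_sq {s : ℝ} (k : ℝ) (hk : 0 < k) :
    Real.sqrt (Real.pi / (k ^ 2 * s)) = Real.sqrt (Real.pi / s) / k := by
  rw [show Real.pi / (k ^ 2 * s) = Real.pi / s / k ^ 2 by rw [div_div, mul_comm],
    Real.sqrt_div' _ (by positivity), Real.sqrt_sq hk.le]

theorem lt_tsum_profile_mul_sq {t : ℝ} (ht : 0 < t) (ht' : t ≤ 4 / 5)
    (hs : Summable fun n : ℤ => profile (t * (n : ℝ) ^ 2)) :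
    0.04 < ∑' n : ℤ, profile (t * (n : ℝ) ^ 2) := by
  have hsum (k : ℝ) (hk : 0 < k) : HasSum (fun n : ℤ => Real.exp (-(k * (t * (n : ℝ) ^ 2))))
      (gaussTheta (k * t)) := by
    have := (summable_gaussTheta (by positivity : 0 < k * t)).hasSum
    unfold gaussTheta
    simpa only [mul_assoc] using this
  have h1 := hsum 1 one_pos
  simp only [one_mul] at h1
  have hlow := (((h1.sub (hsum 1.1025 (by norm_num))).div_const 0.1025).sub
    (((hsum (2 / 1.21) (by norm_num)).sub (hsum 2 two_pos)).div_const (0.21 / 1.21)))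
  have hle := hasSum_le (fun n : ℤ => le_profile (t * (n : ℝ) ^ 2)) hlow hs.hasSum
  refine lt_of_lt_of_le ?_ hle
  have b1 := le_gaussTheta ht
  have b2 := gaussTheta_le_mul (s := 1.1025 * t) (by positivity) (by linarith)
  have b3 := gaussTheta_le_mul (s := 2 / 1.21 * t) (by positivity) (by norm_num; linarith)
  have b4 := le_gaussTheta (s := 2 * t) (by positivity)
  have h2 := Real.sq_sqrt (show (0 : ℝ) ≤ 2 by norm_num)
  have h2' : 0 < Real.sqrt 2 := by positivity
  -- The ratios `1.05²` and `1.1²` were squares so that every theta bound becomes a multiple of `R =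
  -- √(π/t)`, with `√2` the only irrational factor. The resulting coefficient of `R` is about
  -- `0.029`, and `R ≥ 1.98`.
  rw [show (1.1025 : ℝ) = 1.05 ^ 2 by norm_num, sqrt_pi_div_mul_sq _ (by norm_num)] at b2
  rw [show (2 / 1.21 : ℝ) = (Real.sqrt 2 / 1.1) ^ 2 by rw [div_pow, h2]; norm_num,
    sqrt_pi_div_mul_sq _ (by positivity)] at b3
  nth_rewrite 1 [show (2 : ℝ) = Real.sqrt 2 ^ 2 from h2.symm] at b4
  rw [sqrt_pi_div_mul_sq _ (by positivity)] at b4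
  rw [div_pow, h2] at b3
  norm_num at b2 b3 b4 ⊢
  have hR : 1.98 ≤ Real.sqrt (Real.pi / t) := by
    apply Real.le_sqrt_of_sq_le
    rw [le_div_iff₀ ht]
    nlinarith [Real.pi_gt_d4]
  have hinv : Real.sqrt (Real.pi / t) / Real.sqrt 2 ≤ 0.7072 * Real.sqrt (Real.pi / t) := by
    rw [div_le_iff₀ h2']
    have : 1.4142 ≤ Real.sqrt 2 := Real.le_sqrt_of_sq_le (by norm_num)
    nlinarith
  generalize Real.sqrt (Real.pi / t) = R at *
  have b3' : R / (Real.sqrt 2 / (11 / 10)) = R / Real.sqrt 2 * 1.1 := by field_simp; norm_num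
  rw [b3'] at b3
  linarith

/-- Vectors with `m ≠ 0` have `Q_y ≥ y`, so their arguments exceed `4/5` and they may be dropped.
The row `m = 0` is kept whole because it can contain negative terms. -/
theorem tsum_profile_mul_sq_le_halfEnergy {c y : ℝ} (hc : 6.28 ≤ c) (hy : Real.sqrt 3 / 2 < y) :
    (Summable fun n : ℤ => profile (c / y * (n : ℝ) ^ 2)) ∧
      ∑' n : ℤ, profile (c / y * (n : ℝ) ^ 2) ≤ halfEnergy c y := by
  obtain ⟨hs1, hs2⟩ := sqrt_three_mem
  have hy0 : 0 < y := by linarith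
  have hc0 : 0 < c := by linarith
  have hsy := summable_profile_halfForm hc0 hy0
  have hinj : Function.Injective (fun n : ℤ => ((0 : ℤ), n)) := fun a b h => (Prod.ext_iff.1 h).2
  have heq (n : ℤ) : profile (c / y * (n : ℝ) ^ 2) = profile (c * halfForm y (0, n)) := by
    congr 1
    simp [halfForm]
    ring
  simp only [heq]
  refine ⟨hsy.comp_injective hinj, ?_⟩
  set S : Set (ℤ × ℤ) := {p | p.1 = 0} with hS
  set f : ℤ × ℤ → ℝ := fun p => profile (c * halfForm y p) with hf
  have hsupp : Function.support (S.indicator f) ⊆ Set.range (fun n : ℤ => ((0 : ℤ), n)) := by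
    intro p hp
    have hpS : p.1 = 0 := Set.mem_of_indicator_ne_zero (s := S) hp
    exact ⟨p.2, Prod.ext hpS.symm rfl⟩
  have h1 := hinj.tsum_eq hsupp
  have h2 (n : ℤ) : S.indicator f (0, n) = f (0, n) := Set.indicator_of_mem (s := S) rfl f
  simp only [h2] at h1
  rw [h1]
  refine (hsy.indicator S).tsum_le_tsum (fun p => ?_) hsy
  by_cases hp : p ∈ S
  · rw [Set.indicator_of_mem hp]
  · rw [Set.indicator_of_notMem hp]
    have hp1 : p.1 ≠ 0 := hp
    have h1 : (1 : ℝ) ≤ (p.1 : ℝ) ^ 2 := by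
      have : 0 < p.1 ^ 2 := by positivity
      exact_mod_cast this
    have h3 : 0 ≤ ((p.1 : ℝ) / 2 + p.2) ^ 2 / y := by positivity
    have h4 : y ≤ halfForm y p := by unfold halfForm; nlinarith
    apply profile_nonneg
    nlinarith

theorem halfEnergy_lt_of_div_le {c y : ℝ} (hc : 6.28 ≤ c) (hy : Real.sqrt 3 / 2 < y)
    (ht : c / y ≤ 4 / 5) : halfEnergy c (Real.sqrt 3 / 2) < halfEnergy c y := by
  obtain ⟨hs1, hs2⟩ := sqrt_three_mem
  have hu := two_div_sqrt_three_mul_ge hc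
  obtain ⟨hs, hle⟩ := tsum_profile_mul_sq_le_halfEnergy hc hy
  have h0 := halfEnergy_hex_le (c := c) (by linarith)
  have h1 := mul_exp_neg_lt (u := 2 / Real.sqrt 3 * c) (by linarith)
  have h2 := lt_tsum_profile_mul_sq (div_pos (by linarith) (by linarith)) ht hs
  -- The numerical margin is `6.1 * 0.0064 = 0.03904 < 0.04`.
  linarith

/-! ### Assembling the ranges and returning to the half-plane. -/

/-- Among the points `1/2 + iy` with `y ≥ √3/2`, the energy is smallest at `y = √3/2` only. -/
theorem halfEnergy_lt {c y : ℝ} (hc : 6.28 ≤ c) (hy : Real.sqrt 3 / 2 < y) :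
    halfEnergy c (Real.sqrt 3 / 2) < halfEnergy c y := by
  rcases le_total y (6 / 5) with h | h
  · exact halfEnergy_lt_of_le hc hy h
  rcases le_total (4 / 5) (c / y) with h' | h'
  · exact halfEnergy_lt_of_ge hc h h'
  · exact halfEnergy_lt_of_div_le hc hy h'

theorem hexPoint_coe : (hexPoint : ℂ) = Complex.exp ((Real.pi / 3 : ℝ) * Complex.I) := by
  show Complex.exp (Complex.I * (Real.pi / 3)) = _
  congr 1
  push_cast
  ring

theorem hexPoint_re : hexPoint.re = 1 / 2 := by
  rw [← UpperHalfPlane.coe_re, hexPoint_coe, Complex.exp_ofReal_mul_I_re, Real.cos_pi_div_three]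

theorem hexPoint_im : hexPoint.im = Real.sqrt 3 / 2 := by
  rw [← UpperHalfPlane.coe_im, hexPoint_coe, Complex.exp_ofReal_mul_I_im, Real.sin_pi_div_three]

theorem proposition4p3 (α : ℝ) (hα : 2 ≤ α) :
    argminOn (fun z : UpperHalfPlane => latticeK α z - 2 * latticeK (2 * α) z) gammaC
      = {hexPoint} := by
  have hα0 : 0 < α := by linarith
  have hc0 : 0 < Real.pi * α := mul_pos Real.pi_pos hα0
  have hc : 6.28 ≤ Real.pi * α := by nlinarith [Real.pi_gt_d2]
  have hmem : hexPoint ∈ gammaC := ⟨hexPoint_re, hexPoint_im.ge⟩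
  have hlt (z : ℍ) (hz : z ∈ gammaC) (hne : z ≠ hexPoint) :
      latticeK α hexPoint - 2 * latticeK (2 * α) hexPoint
        < latticeK α z - 2 * latticeK (2 * α) z := by
    have him : Real.sqrt 3 / 2 < z.im := by
      refine lt_of_le_of_ne hz.2 fun h => hne ?_
      exact UpperHalfPlane.ext_re_im (hz.1.trans hexPoint_re.symm) (h.symm.trans hexPoint_im.symm)
    have := halfEnergy_lt hc him
    rw [← hexPoint_im, halfEnergy_eq hα0 hexPoint_re, halfEnergy_eq hα0 hz.1] at this
    exact lt_of_mul_lt_mul_left this hc0.le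
  ext z
  rw [Set.mem_singleton_iff]
  constructor
  · rintro ⟨hz, hmin⟩
    by_contra hne
    exact (hlt z hz hne).not_ge (hmin hmem)
  · rintro rfl
    refine ⟨hmem, fun w hw => ?_⟩
    by_cases h : w = hexPoint
    · rw [h]; exact le_refl (latticeK α hexPoint - 2 * latticeK (2 * α) hexPoint)
    · exact (hlt w hw h).le
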